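/- Let $\Gamma_3=\langle a,b,x,y \mid ax=x^{-1}b,\ ay=y^{-1}b^{-1},\ ay^{-1}=xa^{-1},\ bx=yb^{-1}\rangle$, and let $$P=\{(i,j,k,l)\in\mathbb{Z}^4 : a^i x^j = x^{-k} b^l \text{ in } \Gamma_3\}.$$ Then $$P=\{(0,0,0,0)\}\cup\{(0,n,-n,0): n\in\mathbb{Z}\}\cup\{\pm(3^n,-3^n,-3^n,3^n): n\ge 1 \text{ an odd integer}\}\cup\{\pm(3^n,3^n,3^n,3^n): n\ge 0 \text{ an even integer}\}.$$ -/

import Mathlib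

namespace Gamma3

/-- The four generator symbols `a`, `b`, `x`, `y`. -/
inductive Gen : Type
  | a
  | b
  | x
  | y

/-- The four defining relations `ax = x⁻¹b`, `ay = y⁻¹b⁻¹`, `ay⁻¹ = xa⁻¹`, `bx = yb⁻¹`,
as pairs (left side, right side) of elements of the free group on the generators. -/
def relations : Set (FreeGroup Gen × FreeGroup Gen) :=
  let a := FreeGroup.of Gen.a
  let b := FreeGroup.of Gen.b
  let x := FreeGroup.of Gen.x
  let y := FreeGroup.of Gen.y
  {(a * x, x⁻¹ * b), (a * y, y⁻¹ * b⁻¹), (a * y⁻¹, x * a⁻¹), (b * x, y * b⁻¹)}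

/-- The relators `u * v⁻¹` of the relations `u = v`. -/
def relators : Set (FreeGroup Gen) :=
  (fun r => r.1 * r.2⁻¹) '' relations

/-- The group `Γ₃ = ⟨a, b, x, y | ax = x⁻¹b, ay = y⁻¹b⁻¹, ay⁻¹ = xa⁻¹, bx = yb⁻¹⟩`. -/
abbrev Group3 : Type := PresentedGroup relators

/-- The generators, as elements of `Γ₃`. -/
def a : Group3 := PresentedGroup.of Gen.a

def b : Group3 := PresentedGroup.of Gen.b

def x : Group3 := PresentedGroup.of Gen.x

def y : Group3 := PresentedGroup.of Gen.y

/-- The set `P` of all integer tuples `(i, j, k, l)` with `a^i x^j = x^{-k} b^l` in `Γ₃`. -/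
def P : Set (ℤ × ℤ × ℤ × ℤ) :=
  {(i, j, k, l) | a ^ i * x ^ j = x ^ (-k) * b ^ l}

end Gamma3

open Polynomial
open scoped Quaternion

namespace Gamma3

/-! In characteristic three, `Γ₃` acts by quaternions over `(ZMod 3)[X]` with `i² = j² = X`: `a, b,
x, y` go to `1+i, 1+j, 1+i-j, 1+i+j`, each divided by a square root of its norm (`1-X` for `a, b`
and `1+X` for `x, y`). This representation is faithful (`rep_injective`), so membership in `P` is an
identity of quaternions up to scalars.

If `q² = X` then `(1+q)^n = c_n + s_n q`; for `x` the same holds with `X` replaced by `-X`.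
Comparing coordinates (`ratio_cases`, `ratio_of_mem`) leaves the family with `i = l = 0`, or forces
`l = i`, `k = j` and `(s_i/c_i)(X) = (s_j/c_j)(-X)`.

The last equation is solved by descent (`Matched.exists_pow`). Cubing gives `c_{3n} = c_n³`, `s_{3n}
= X s_n³`, so dividing both exponents by 3 preserves the equation up to a sign, which comes from `X
↦ -X`. When 3 does not divide the exponent, a differential equation for `s_n/c_n` leaves only
exponent 1 (`Matched.eq_one`). Hence `|i| = |j| = 3^n`, and the sign relating `j` to `i` is
`(-1)^n`. -/

/-! ### Coefficients of the powers of `1 + q`. -/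

/-- The polynomials `A`, `B` with `(1 + q) ^ n = A + B * q` whenever `q ^ 2 = X`. -/
noncomputable def powCoeff : ℕ → (ZMod 3)[X] × (ZMod 3)[X]
  | 0 => (1, 0)
  | n + 1 => ((powCoeff n).1 + X * (powCoeff n).2, (powCoeff n).1 + (powCoeff n).2)

/-- The coefficient of `1` in `(1 + q) ^ n` where `q ^ 2 = X`. -/
noncomputable def cPow (n : ℕ) : (ZMod 3)[X] := (powCoeff n).1

/-- The coefficient of `q` in `(1 + q) ^ n` where `q ^ 2 = X`. -/
noncomputable def sPow (n : ℕ) : (ZMod 3)[X] := (powCoeff n).2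

@[simp] lemma cPow_zero : cPow 0 = 1 := rfl
@[simp] lemma sPow_zero : sPow 0 = 0 := rfl
lemma cPow_succ (n : ℕ) : cPow (n + 1) = cPow n + X * sPow n := rfl
lemma sPow_succ (n : ℕ) : sPow (n + 1) = cPow n + sPow n := rfl

@[simp] lemma cPow_one : cPow 1 = 1 := by simpa using cPow_succ 0
@[simp] lemma sPow_one : sPow 1 = 1 := by simpa using sPow_succ 0

lemma three_eq_zero : (3 : (ZMod 3)[X]) = 0 := by
  exact_mod_cast CharP.cast_eq_zero (ZMod 3)[X] 3

lemma norm_powCoeff (n : ℕ) : cPow n ^ 2 - X * sPow n ^ 2 = (1 - X) ^ n := by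
  induction n with
  | zero => simp
  | succ n ih => rw [cPow_succ, sPow_succ, pow_succ (1 - X), ← ih]; ring

lemma add_powCoeff (m n : ℕ) :
    cPow (m + n) = cPow m * cPow n + X * sPow m * sPow n ∧
      sPow (m + n) = cPow m * sPow n + sPow m * cPow n := by
  induction n with
  | zero => simp
  | succ n ih =>
    rw [← add_assoc, cPow_succ, sPow_succ, cPow_succ, sPow_succ, ih.1, ih.2]
    constructor <;> ring

lemma cPow_three_mul (n : ℕ) : cPow (3 * n) = cPow n ^ 3 := by
  rw [show 3 * n = n + n + n by ring, (add_powCoeff _ _).1, (add_powCoeff _ _).1,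
    (add_powCoeff _ _).2]
  linear_combination X * cPow n * sPow n ^ 2 * three_eq_zero

lemma sPow_three_mul (n : ℕ) : sPow (3 * n) = X * sPow n ^ 3 := by
  rw [show 3 * n = n + n + n by ring, (add_powCoeff _ _).2, (add_powCoeff _ _).1,
    (add_powCoeff _ _).2]
  linear_combination cPow n ^ 2 * sPow n * three_eq_zero

lemma eval_zero_cPow (n : ℕ) : (cPow n).eval 0 = 1 := by
  induction n with
  | zero => simp
  | succ n ih => simp [cPow_succ, ih]

lemma eval_one_powCoeff_succ (n : ℕ) :
    (cPow (n + 1)).eval 1 = 2 ^ n ∧ (sPow (n + 1)).eval 1 = 2 ^ n := by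
  induction n with
  | zero => simp [cPow_succ, sPow_succ]
  | succ n ih => simp [cPow_succ (n + 1), sPow_succ (n + 1), ih, pow_succ, mul_two]

lemma eval_one_cPow_ne_zero (n : ℕ) : (cPow n).eval 1 ≠ 0 := by
  cases n with
  | zero => simp
  | succ n => rw [(eval_one_powCoeff_succ n).1]; exact pow_ne_zero _ (by decide)

lemma cPow_ne_zero (n : ℕ) : cPow n ≠ 0 := by
  intro h; simpa [h] using eval_one_cPow_ne_zero n

lemma sPow_ne_zero {n : ℕ} (hn : n ≠ 0) : sPow n ≠ 0 := by
  obtain ⟨n, rfl⟩ := Nat.exists_eq_succ_of_ne_zero hn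
  intro h
  have := (eval_one_powCoeff_succ n).2
  rw [h, eval_zero] at this
  exact pow_ne_zero _ (by decide) this.symm

/-- These are the coefficients of `1` and `q` in `(1+q) · d/dq (1+q)^n = n (1+q)^n`, where `X = q²`
gives `dX/dq = 2q`. -/
lemma derivative_powCoeff (n : ℕ) :
    sPow n + 2 * X * derivative (sPow n) + 2 * X * derivative (cPow n) = (n : (ZMod 3)[X]) * cPow n ∧
      2 * derivative (cPow n) + sPow n + 2 * X * derivative (sPow n) = (n : (ZMod 3)[X]) * sPow n := by
  induction n with
  | zero => simp
  | succ n ih =>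
    simp only [cPow_succ, sPow_succ, derivative_add, derivative_mul, derivative_X, one_mul,
      Nat.cast_add, Nat.cast_one]
    constructor
    · linear_combination ih.1 + X * ih.2
    · linear_combination ih.1 + ih.2

/-- The logarithmic derivative of `sPow n / cPow n`, with denominators cleared. -/
lemma wronskian_powCoeff (n : ℕ) :
    (1 - X) * (cPow n * (sPow n + 2 * X * derivative (sPow n)) -
      2 * X * derivative (cPow n) * sPow n) =
      (n : (ZMod 3)[X]) * (cPow n ^ 2 - X * sPow n ^ 2) := by
  obtain ⟨h1, h2⟩ := derivative_powCoeff n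
  linear_combination (cPow n + X * sPow n) * h1 - (X * cPow n + X * sPow n) * h2

/-- The norm identity turns equal ratios into `c_n² (1-X)^m = c_m² (1-X)^n`. No `c_n` vanishes at `X
= 1`, so the powers of `1-X` must agree. -/
lemma powCoeff_inj {m n : ℕ} (h : sPow m ^ 2 * cPow n ^ 2 = sPow n ^ 2 * cPow m ^ 2) : m = n := by
  have key : cPow n ^ 2 * (1 - X) ^ m = cPow m ^ 2 * (1 - X) ^ n := by
    rw [← norm_powCoeff, ← norm_powCoeff]; linear_combination -X * h
  have hX : (1 - X : (ZMod 3)[X]) ≠ 0 := by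
    intro h0; simpa using congrArg (eval 0) h0
  wlog hmn : m ≤ n generalizing m n
  · exact (this h.symm key.symm (by lia)).symm
  obtain ⟨d, rfl⟩ := Nat.exists_eq_add_of_le hmn
  rw [pow_add, mul_left_comm, mul_comm (cPow _ ^ 2)] at key
  have := congrArg (eval 1) (mul_left_cancel₀ (pow_ne_zero m hX) key)
  cases d with
  | zero => rfl
  | succ d =>
    simp at this
    exact absurd this (eval_one_cPow_ne_zero _)

/-! ### The ratio equation, solved by descent on powers of 3. -/

/-- `BC = σDA` where `A`, `B` belong to the exponent `m`, and `C`, `D` to `n` with `X ↦ -X`. -/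
def Matched (σ : ℤ) (m n : ℕ) : Prop :=
  sPow m * (cPow n).comp (-X) = σ * (sPow n).comp (-X) * cPow m

/-- The ratio `u = s_m/c_m` satisfies `(1-X)(u + 2Xu') = m(1 - Xu²)`. The operator `u ↦ u + 2Xu'`
commutes with `X ↦ -X`, so applying it to both sides of the matching equation eliminates all
derivatives. -/
lemma Matched.wronskian {σ : ℤ} {m n : ℕ} (h : Matched σ m n) :
    (m : (ZMod 3)[X]) * (cPow m ^ 2 - X * sPow m ^ 2) * (1 + X) * (cPow n).comp (-X) ^ 2 =
      (σ : (ZMod 3)[X]) * (n : (ZMod 3)[X]) * ((cPow n).comp (-X) ^ 2 + X * (sPow n).comp (-X) ^ 2) * (1 - X) * cPow m ^ 2 := by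
  have w1 := wronskian_powCoeff m
  have w2 := congrArg (fun p => p.comp (-X)) (wronskian_powCoeff n)
  have h' := congrArg derivative h
  unfold Matched at h
  simp only [derivative_mul, derivative_comp, derivative_neg, derivative_X, derivative_intCast]
    at h'
  simp only [mul_comp, sub_comp, add_comp, one_comp, X_comp, pow_comp, natCast_comp, ofNat_comp]
    at w2
  set A := cPow m
  set B := sPow m
  set C := (cPow n).comp (-X)
  set D := (sPow n).comp (-X)
  set A' := derivative A
  set B' := derivative B
  set C' := (derivative (cPow n)).comp (-X)
  set D' := (derivative (sPow n)).comp (-X)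
  linear_combination (-(1 + X) * C ^ 2) * w1 + σ * (1 - X) * A ^ 2 * w2
    + (1 - X) * (1 + X) * ((A * C - 2 * X * C * A' + 2 * X * A * C') * h + 2 * X * A * C * h')

lemma Matched.eq_one {σ : ℤ} (hσ : σ = 1 ∨ σ = -1) {m n : ℕ} (h : Matched σ m n)
    (hm : (m : ZMod 3) ≠ 0) : m = 1 ∧ n = 1 ∧ σ = 1 := by
  have key := h.wronskian
  have hmod : (m : ZMod 3) = σ * n := by
    simpa [eval_comp, eval_zero_cPow] using congrArg (eval 0) key
  have hmod' : (m : (ZMod 3)[X]) = σ * n := by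
    simpa using congrArg C hmod
  have hm' : (m : (ZMod 3)[X]) ≠ 0 := by
    intro h0; apply hm; simpa using congrArg (eval 0) h0
  unfold Matched at h
  have hσ2 : (σ : (ZMod 3)[X]) ^ 2 = 1 := by rcases hσ with rfl | rfl <;> simp
  have hC : (cPow n).comp (-X) ≠ 0 := by
    intro h0
    have := congrArg (eval 0) h0
    simp [eval_comp, eval_zero_cPow] at this
  have hA := cPow_ne_zero m
  have n1 := norm_powCoeff m
  have n2 := congrArg (fun p => p.comp (-X)) (norm_powCoeff n)
  simp only [mul_comp, sub_comp, one_comp, X_comp, pow_comp] at n2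
  have e1 : (cPow n).eval 1 ≠ 0 := eval_one_cPow_ne_zero n
  have e2 : eval (-1) ((cPow n).comp (-X)) = eval 1 (cPow n) := by simp [eval_comp]
  set A := cPow m
  set B := sPow m
  set C := (cPow n).comp (-X)
  set D := (sPow n).comp (-X)
  have h2 : B ^ 2 * C ^ 2 = D ^ 2 * A ^ 2 := by
    linear_combination (B * C + σ * D * A) * h + D ^ 2 * A ^ 2 * hσ2
  have key2 : (A ^ 2 - X * B ^ 2) * (1 + X) * C ^ 2 = (C ^ 2 + X * D ^ 2) * (1 - X) * A ^ 2 := by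
    apply mul_left_cancel₀ hm'
    linear_combination key - (C ^ 2 + X * D ^ 2) * (1 - X) * A ^ 2 * hmod'
  -- Eliminating `D` from `key2` by `h2` leaves `2X C² (A² - B²) = 0`.
  have hBA : B ^ 2 = A ^ 2 := by
    apply mul_left_cancel₀ (mul_ne_zero X_ne_zero (pow_ne_zero 2 hC))
    linear_combination key2 - X * C ^ 2 * (A ^ 2 - B ^ 2) * three_eq_zero - X * (1 - X) * h2
  have hDC : D ^ 2 = C ^ 2 := by
    apply mul_left_cancel₀ (pow_ne_zero 2 hA)
    linear_combination C ^ 2 * hBA - h2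
  have hm1 : m = 1 := by
    rcases m with _ | _ | m
    · simp at hm
    · rfl
    -- With `B² = A²` the norm identity makes `A²` a power of `1-X`; the exponent is positive here,
    -- although `A` does not vanish at `X = 1`.
    · have : A ^ 2 = (1 - X) ^ (m + 1) := by
        have hX : (1 - X : (ZMod 3)[X]) ≠ 0 := by
          intro h0; simpa using congrArg (eval 0) h0
        apply mul_left_cancel₀ hX
        linear_combination n1 + X * hBA
      have := congrArg (eval 1) this
      simp at this
      exact absurd this (eval_one_cPow_ne_zero _)
  have hn1 : n = 1 := by
    rcases n with _ | _ | n
    · simp [hmod] at hm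
    · rfl
    · have : C ^ 2 = (1 + X) ^ (n + 1) := by
        have hX : (1 + X : (ZMod 3)[X]) ≠ 0 := by
          intro h0; simpa using congrArg (eval 0) h0
        apply mul_left_cancel₀ hX
        linear_combination n2 - X * hDC
      have := congrArg (eval (-1)) this
      rw [eval_pow, e2] at this
      simp at this
      exact absurd this e1
  refine ⟨hm1, hn1, ?_⟩
  rcases hσ with rfl | rfl
  · rfl
  · subst hm1 hn1
    revert hmod; decide

/-- The factor `X` in `s_{3n} = X s_n³` becomes `-X` on one side only, hence the sign change; the
remaining cubes are removed by injectivity of Frobenius. -/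
lemma Matched.of_three_mul {σ : ℤ} (hσ : σ = 1 ∨ σ = -1) {m n : ℕ}
    (h : Matched σ (3 * m) (3 * n)) : Matched (-σ) m n := by
  unfold Matched at *
  rw [cPow_three_mul, sPow_three_mul, cPow_three_mul, sPow_three_mul] at h
  simp only [mul_comp, X_comp, pow_comp] at h
  have hσ3 : (σ : (ZMod 3)[X]) ^ 3 = σ := by rcases hσ with rfl | rfl <;> norm_num
  apply frobenius_inj (ZMod 3)[X] 3
  simp only [frobenius_def]
  apply mul_left_cancel₀ (X_ne_zero (R := ZMod 3))
  push_cast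
  linear_combination h + X * (sPow n).comp (-X) ^ 3 * cPow m ^ 3 * hσ3

lemma Matched.three_mul {σ : ℤ} (hσ : σ = 1 ∨ σ = -1) {m n : ℕ}
    (h : Matched σ m n) : Matched (-σ) (3 * m) (3 * n) := by
  unfold Matched at *
  rw [cPow_three_mul, sPow_three_mul, cPow_three_mul, sPow_three_mul]
  simp only [mul_comp, X_comp, pow_comp]
  have hσ3 : (σ : (ZMod 3)[X]) ^ 3 = σ := by rcases hσ with rfl | rfl <;> norm_num
  have h3 := congrArg (· ^ 3) h
  simp only [mul_pow, hσ3] at h3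
  push_cast
  linear_combination X * h3

lemma matched_three_pow (k : ℕ) : Matched ((-1) ^ k) (3 ^ k) (3 ^ k) := by
  induction k with
  | zero => simp [Matched]
  | succ k ih =>
    have := ih.three_mul (neg_one_pow_eq_or ℤ k)
    rwa [← pow_succ', ← neg_one_mul, ← pow_succ'] at this

lemma Matched.exists_pow {σ : ℤ} (hσ : σ = 1 ∨ σ = -1) {m n : ℕ} (hm : m ≠ 0)
    (h : Matched σ m n) : ∃ k : ℕ, m = 3 ^ k ∧ n = 3 ^ k ∧ σ = (-1) ^ k := by
  induction m using Nat.strong_induction_on generalizing n σ with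
  | _ m ih =>
    by_cases h3 : (m : ZMod 3) = 0
    · have hn : (n : ZMod 3) = 0 := by
        have hmod : (m : ZMod 3) = σ * n := by
          simpa [eval_comp, eval_zero_cPow] using congrArg (eval 0) h.wronskian
        rw [h3] at hmod
        rcases hσ with rfl | rfl <;> simpa [eq_comm] using hmod
      rw [ZMod.natCast_eq_zero_iff] at h3 hn
      obtain ⟨m, rfl⟩ := h3
      obtain ⟨n, rfl⟩ := hn
      obtain ⟨k, rfl, rfl, hk⟩ := ih m (by lia) (by lia) (by lia) (h.of_three_mul hσ)
      exact ⟨k + 1, by ring, by ring, by rw [pow_succ, ← hk]; ring⟩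
    · obtain ⟨rfl, rfl, rfl⟩ := h.eq_one hσ h3
      exact ⟨0, by simp⟩

/-! ### Reduced words and the quaternions of the generators. -/

section Words

/-- A reduced word in letters with `e p * e q * e p = ± e p` unless `q` is inverse to `p`
has nonzero product. -/
lemma prod_map_ne_zero_of_isReduced {ι S : Type*} [Ring S] [Nontrivial S] {e : ι × Bool → S}
    (h0 : ∀ p, e p ≠ 0)
    (he : ∀ p q : ι × Bool, (p.1 = q.1 → p.2 = q.2) →
      e p * e q * e p = e p ∨ e p * e q * e p = -e p)
    {w : List (ι × Bool)} (hw : FreeGroup.IsReduced w) : (w.map e).prod ≠ 0 := by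
  induction w with
  | nil => simp
  | cons p w ih =>
    cases w with
    | nil => simpa using h0 p
    | cons q w =>
      rw [FreeGroup.isReduced_cons_cons] at hw
      intro h
      apply ih hw.2
      simp only [List.map_cons, List.prod_cons] at h ⊢
      -- Left multiplication by `e q` collapses `e q * e p * e q` to `± e q`, giving a vanishing
      -- product for a shorter reduced word.
      have h2 : e q * e p * e q * (w.map e).prod = 0 := by
        simp only [mul_assoc]; rw [h, mul_zero]
      rcases he q p (fun h => (hw.1 h.symm).symm) with h3 | h3
      · rwa [h3] at h2
      · rw [h3, neg_mul] at h2; exact neg_eq_zero.mp h2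

end Words

/-- The generators `a`, `b`. -/
def horizontal : Bool → Gen := fun s => cond s Gen.a Gen.b

/-- The generators `x`, `y`. -/
def vertical : Bool → Gen := fun s => cond s Gen.x Gen.y

section Quaternion

variable {R S : Type*} [CommRing R] [CommRing S]

/-- The pure quaternion attached to a generator. -/
def dir (c : R) : Gen → ℍ[R,c,0,c]
  | Gen.a => ⟨0, 1, 0, 0⟩
  | Gen.b => ⟨0, 0, 1, 0⟩
  | Gen.x => ⟨0, 1, -1, 0⟩
  | Gen.y => ⟨0, 1, 1, 0⟩

/-- The quaternion attached to a generator or the inverse of a generator. -/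
def letter (c : R) (p : Gen × Bool) : ℍ[R,c,0,c] := cond p.2 (1 + dir c p.1) (1 - dir c p.1)

/-- The square of the pure quaternion of a generator (in characteristic three). -/
def dirSq (c : R) : Gen → R
  | Gen.a => c
  | Gen.b => c
  | Gen.x => -c
  | Gen.y => -c

lemma dir_mul_dir (h3 : (3 : R) = 0) (c : R) (g : Gen) :
    dir c g * dir c g = ((dirSq c g : R) : ℍ[R,c,0,c]) := by
  cases g <;> ext <;> simp [dir, dirSq] <;> linear_combination c * h3

/-- Base change of quaternion algebras. -/
def quatMap (f : R →+* S) {c : R} {d : S} (h : f c = d) : ℍ[R,c,0,c] →+* ℍ[S,d,0,d] where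
  toFun q := ⟨f q.re, f q.imI, f q.imJ, f q.imK⟩
  map_one' := by ext <;> simp
  map_zero' := by ext <;> simp
  map_add' p q := by ext <;> simp
  map_mul' p q := by ext <;> simp [h]

lemma quatMap_dir (f : R →+* S) {c : R} {d : S} (h : f c = d) (g : Gen) :
    quatMap f h (dir c g) = dir d g := by
  cases g <;> ext <;> simp [quatMap, dir]

lemma quatMap_letter (f : R →+* S) {c : R} {d : S} (h : f c = d) (p : Gen × Bool) :
    quatMap f h (letter c p) = letter d p := by
  obtain ⟨g, s⟩ := p
  cases s <;> simp [letter, quatMap_dir]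

lemma quatMap_coe (f : R →+* S) {c : R} {d : S} (h : f c = d) (r : R) :
    quatMap f h (r : ℍ[R,c,0,c]) = (f r : ℍ[S,d,0,d]) := by
  ext <;> simp [quatMap]

lemma letter_mul_star (h3 : (3 : R) = 0) (c : R) (p : Gen × Bool) :
    letter c p * star (letter c p) = ((1 - dirSq c p.1 : R) : ℍ[R,c,0,c]) := by
  obtain ⟨g, s⟩ := p
  cases g <;> cases s <;> ext <;> simp [letter, dir, dirSq] <;>
    first | linear_combination (-c) * h3 | linear_combination c * h3 | ring

lemma star_letter (c : R) (g : Gen) (s : Bool) : star (letter c (g, s)) = letter c (g, !s) := by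
  cases g <;> cases s <;> ext <;> simp [letter, dir]

end Quaternion

/-- At `X = 1` the norm `1 - X` vanishes, so the letters are zero divisors; the collapsing
identities are a finite check over `ZMod 3`. The vertical letters degenerate in the same way at `X =
-1`. -/
lemma horizontal_word_ne_zero {w : List (Bool × Bool)} (hw : FreeGroup.IsReduced w) :
    (w.map fun p => letter (1 : ZMod 3) (horizontal p.1, p.2)).prod ≠ 0 := by
  apply prod_map_ne_zero_of_isReduced _ _ hw
  · simp only [ne_eq, QuaternionAlgebra.ext_iff]; decide
  · simp only [QuaternionAlgebra.ext_iff]; decide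

lemma vertical_word_ne_zero {w : List (Bool × Bool)} (hw : FreeGroup.IsReduced w) :
    (w.map fun p => letter (-1 : ZMod 3) (vertical p.1, p.2)).prod ≠ 0 := by
  apply prod_map_ne_zero_of_isReduced _ _ hw
  · simp only [ne_eq, QuaternionAlgebra.ext_iff]; decide
  · simp only [QuaternionAlgebra.ext_iff]; decide

/-! ### Normal form: a horizontal word times a vertical word. -/

section NormalForm

lemma mk_relation {u v : FreeGroup Gen} (h : (u, v) ∈ relations) :
    PresentedGroup.mk relators u = PresentedGroup.mk relators v :=
  PresentedGroup.mk_eq_mk_of_mul_inv_mem ⟨_, h, rfl⟩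

lemma relation_ax : a * x = x⁻¹ * b := by
  have := mk_relation (u := .of .a * .of .x) (v := (.of .x)⁻¹ * .of .b) (by simp [relations])
  simp only [map_mul, map_inv] at this
  exact this

lemma relation_ay : a * y = y⁻¹ * b⁻¹ := by
  have := mk_relation (u := .of .a * .of .y) (v := (.of .y)⁻¹ * (.of .b)⁻¹) (by simp [relations])
  simp only [map_mul, map_inv] at this
  exact this

lemma relation_ay_inv : a * y⁻¹ = x * a⁻¹ := by
  have := mk_relation (u := .of .a * (.of .y)⁻¹) (v := .of .x * (.of .a)⁻¹) (by simp [relations])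
  simp only [map_mul, map_inv] at this
  exact this

lemma relation_bx : b * x = y * b⁻¹ := by
  have := mk_relation (u := .of .b * .of .x) (v := .of .y * (.of .b)⁻¹) (by simp [relations])
  simp only [map_mul, map_inv] at this
  exact this

/-- The generators `a`, `b` and their inverses. -/
def horizontalLetters : Set Group3 := {a, b, a⁻¹, b⁻¹}

/-- The generators `x`, `y` and their inverses. -/
def verticalLetters : Set Group3 := {x, y, x⁻¹, y⁻¹}

lemma exists_swap_letter {s t : Group3} (hs : s ∈ verticalLetters) (ht : t ∈ horizontalLetters) :
    ∃ t' ∈ horizontalLetters, ∃ s' ∈ verticalLetters, s * t = t' * s' := by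
  -- Each relation is a square that can be read from its four corners; the four relations thus cover
  -- all sixteen pairs of a vertical and a horizontal letter.
  have key : ∀ {p q r u : Group3}, p * q = r * u → q * u⁻¹ = p⁻¹ * r ∧ r⁻¹ * p = u * q⁻¹ ∧
      u⁻¹ * r⁻¹ = q⁻¹ * p⁻¹ := by
    intro p q r u h
    refine ⟨?_, ?_, ?_⟩
    · rw [eq_inv_mul_iff_mul_eq, ← mul_assoc, h, mul_inv_cancel_right]
    · rw [inv_mul_eq_iff_eq_mul, ← mul_assoc, ← h, mul_inv_cancel_right]
    · rw [← mul_inv_rev, ← mul_inv_rev, h]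
  have e1 := relation_ax
  have e2 := relation_ay
  have e3 := relation_ay_inv
  have e4 := relation_bx
  have f1 := key e1
  have f2 := key e2
  have f3 := key e3
  have f4 := key e4
  simp only [inv_inv] at f1 f2 f3 f4
  simp only [verticalLetters, horizontalLetters, Set.mem_insert_iff, Set.mem_singleton_iff,
    exists_eq_or_imp, exists_eq_left] at *
  grind

end NormalForm

section NormalForm

/-- The subgroup generated by `a` and `b`. -/
def horizontalSubgroup : Subgroup Group3 := Subgroup.closure {a, b}

/-- The subgroup generated by `x` and `y`. -/
def verticalSubgroup : Subgroup Group3 := Subgroup.closure {x, y}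

lemma mem_of_mem_horizontalLetters {t : Group3} (ht : t ∈ horizontalLetters) :
    t ∈ horizontalSubgroup := by
  have ha : a ∈ horizontalSubgroup := Subgroup.subset_closure (by simp)
  have hb : b ∈ horizontalSubgroup := Subgroup.subset_closure (by simp)
  rcases ht with rfl | rfl | rfl | rfl
  exacts [ha, hb, inv_mem ha, inv_mem hb]

lemma mem_of_mem_verticalLetters {t : Group3} (ht : t ∈ verticalLetters) :
    t ∈ verticalSubgroup := by
  have hx : x ∈ verticalSubgroup := Subgroup.subset_closure (by simp)
  have hy : y ∈ verticalSubgroup := Subgroup.subset_closure (by simp)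
  rcases ht with rfl | rfl | rfl | rfl
  exacts [hx, hy, inv_mem hx, inv_mem hy]

lemma exists_swap {h : Group3} (hh : h ∈ horizontalSubgroup) :
    ∀ s ∈ verticalLetters,
      ∃ h' ∈ horizontalSubgroup, ∃ s' ∈ verticalLetters, s * h = h' * s' := by
  have step : ∀ t ∈ horizontalLetters, ∀ y : Group3,
      (∀ s ∈ verticalLetters,
        ∃ h' ∈ horizontalSubgroup, ∃ s' ∈ verticalLetters, s * y = h' * s') →
      ∀ s ∈ verticalLetters,
        ∃ h' ∈ horizontalSubgroup, ∃ s' ∈ verticalLetters, s * (t * y) = h' * s' := by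
    intro t ht y ih s hs
    obtain ⟨t', ht', s', hs', e⟩ := exists_swap_letter hs ht
    obtain ⟨h', hh', s'', hs'', e'⟩ := ih s' hs'
    exact ⟨t' * h', mul_mem (mem_of_mem_horizontalLetters ht') hh', s'', hs'', by
      rw [← mul_assoc, e, mul_assoc, e', mul_assoc]⟩
  induction hh using Subgroup.closure_induction_left with
  | one => exact fun s hs => ⟨1, one_mem _, s, hs, by simp⟩
  | mul_left t ht y _ ih =>
    exact step t (by rcases ht with rfl | rfl <;> simp [horizontalLetters]) y ih
  | inv_mul_cancel t ht y _ ih =>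
    exact step t⁻¹ (by rcases ht with rfl | rfl <;> simp [horizontalLetters]) y ih

lemma exists_eq_mul (g : Group3) :
    ∃ h ∈ horizontalSubgroup, ∃ v ∈ verticalSubgroup, g = h * v := by
  have hstep : ∀ t ∈ horizontalLetters, ∀ y : Group3,
      (∃ h ∈ horizontalSubgroup, ∃ v ∈ verticalSubgroup, y = h * v) →
      ∃ h ∈ horizontalSubgroup, ∃ v ∈ verticalSubgroup, t * y = h * v := by
    rintro t ht _ ⟨h, hh, v, hv, rfl⟩
    exact ⟨t * h, mul_mem (mem_of_mem_horizontalLetters ht) hh, v, hv, by rw [mul_assoc]⟩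
  have vstep : ∀ s ∈ verticalLetters, ∀ y : Group3,
      (∃ h ∈ horizontalSubgroup, ∃ v ∈ verticalSubgroup, y = h * v) →
      ∃ h ∈ horizontalSubgroup, ∃ v ∈ verticalSubgroup, s * y = h * v := by
    rintro s hs _ ⟨h, hh, v, hv, rfl⟩
    obtain ⟨h', hh', s', hs', e⟩ := exists_swap hh s hs
    exact ⟨h', hh', s' * v, mul_mem (mem_of_mem_verticalLetters hs') hv, by
      rw [← mul_assoc, e, mul_assoc]⟩
  have hg : g ∈ Subgroup.closure (Set.range (PresentedGroup.of : Gen → Group3)) := by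
    rw [PresentedGroup.closure_range_of]; trivial
  induction hg using Subgroup.closure_induction_left with
  | one => exact ⟨1, one_mem _, 1, one_mem _, by simp⟩
  | mul_left t ht y _ ih =>
    obtain ⟨g, rfl⟩ := ht
    cases g
    · exact hstep _ (Or.inl rfl) _ ih
    · exact hstep _ (Or.inr (Or.inl rfl)) _ ih
    · exact vstep _ (Or.inl rfl) _ ih
    · exact vstep _ (Or.inr (Or.inl rfl)) _ ih
  | inv_mul_cancel t ht y _ ih =>
    obtain ⟨g, rfl⟩ := ht
    cases g
    · exact hstep _ (Or.inr (Or.inr (Or.inl rfl))) _ ih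
    · exact hstep _ (Or.inr (Or.inr (Or.inr rfl))) _ ih
    · exact vstep _ (Or.inr (Or.inr (Or.inl rfl))) _ ih
    · exact vstep _ (Or.inr (Or.inr (Or.inr rfl))) _ ih

lemma exists_normal_form (g : Group3) : ∃ h v : FreeGroup Bool,
    g = FreeGroup.lift (fun s => (PresentedGroup.of (horizontal s) : Group3)) h *
      FreeGroup.lift (fun s => (PresentedGroup.of (vertical s) : Group3)) v := by
  obtain ⟨h, hh, v, hv, rfl⟩ := exists_eq_mul g
  have eh : horizontalSubgroup =
      (FreeGroup.lift (fun s => (PresentedGroup.of (horizontal s) : Group3))).range := by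
    rw [FreeGroup.range_lift_eq_closure, horizontalSubgroup]
    congr 1
    ext t; simp [horizontal, a, b, or_comm]
  have ev : verticalSubgroup =
      (FreeGroup.lift (fun s => (PresentedGroup.of (vertical s) : Group3))).range := by
    rw [FreeGroup.range_lift_eq_closure, verticalSubgroup]
    congr 1
    ext t; simp [vertical, x, y, or_comm]
  rw [eh] at hh
  rw [ev] at hv
  obtain ⟨h, rfl⟩ := hh
  obtain ⟨v, rfl⟩ := hv
  exact ⟨h, v, rfl⟩

end NormalForm

/-! ### The quaternion representation. -/

section Representation

/-- A field of characteristic three containing a transcendental element and square roots of the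
norms of the generators. -/
structure Splitting (L : Type*) [Field L] where
  /-- The embedding of the polynomial ring. -/
  emb : (ZMod 3)[X] →+* L
  injective : Function.Injective emb
  /-- The square root of the norm of a generator. -/
  root : Gen → L
  root_b : root Gen.b = root Gen.a
  root_y : root Gen.y = root Gen.x
  root_sq : ∀ g, root g ^ 2 = emb (1 - dirSq X g)

lemma one_sub_dirSq_ne_zero (g : Gen) : (1 - dirSq X g : (ZMod 3)[X]) ≠ 0 := by
  intro h
  have := congrArg (eval 0) h
  cases g <;> simp [dirSq] at this

lemma exists_splitting : ∃ (L : Type) (_ : Field L), Nonempty (Splitting L) := by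
  refine ⟨AlgebraicClosure (RatFunc (ZMod 3)), inferInstance, ?_⟩
  set f := (algebraMap (RatFunc (ZMod 3)) (AlgebraicClosure (RatFunc (ZMod 3)))).comp
    (algebraMap (ZMod 3)[X] (RatFunc (ZMod 3))) with hf
  have hinj : Function.Injective f := by
    rw [hf, RingHom.coe_comp]
    exact (RingHom.injective _).comp (RatFunc.algebraMap_injective (ZMod 3))
  have hroot : ∀ p, ∃ z, z ^ 2 = f p := fun p =>
    IsAlgClosed.exists_pow_nat_eq (f p) (by norm_num)
  choose r hr using hroot
  exact ⟨⟨f, hinj, fun g => r (1 - dirSq X g), rfl, rfl, fun g => hr _⟩⟩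

variable {L : Type*} [Field L] (σ : Splitting L)

namespace Splitting

lemma root_ne_zero (g : Gen) : σ.root g ≠ 0 := by
  intro h
  have h1 := σ.root_sq g
  rw [h, zero_pow two_ne_zero, eq_comm, map_eq_zero_iff _ σ.injective] at h1
  exact one_sub_dirSq_ne_zero g h1

lemma three_eq_zero {L : Type*} [Field L] (σ : Splitting L) : (3 : L) = 0 := by
  rw [← map_ofNat σ.emb 3, Gamma3.three_eq_zero, map_zero]

/-- The image of `X`. -/
noncomputable def t : L := σ.emb X

lemma emb_dirSq (g : Gen) : σ.emb (dirSq X g) = dirSq σ.t g := by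
  cases g <;> simp [dirSq, t]

/-- The normalized quaternion of a letter. -/
noncomputable def val (p : Gen × Bool) : ℍ[L,σ.t,0,σ.t] := (σ.root p.1)⁻¹ • letter σ.t p

lemma val_mul_val_not (g : Gen) (s : Bool) : σ.val (g, s) * σ.val (g, !s) = 1 := by
  have h := letter_mul_star σ.three_eq_zero σ.t (g, s)
  rw [star_letter] at h
  rw [val, val, smul_mul_smul_comm, h, ← mul_inv, ← pow_two, σ.root_sq, map_sub, map_one,
    σ.emb_dirSq, QuaternionAlgebra.smul_coe, inv_mul_cancel₀]
  · rfl
  · rw [← σ.emb_dirSq, ← map_one σ.emb, ← map_sub, ← σ.root_sq]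
    exact pow_ne_zero 2 (σ.root_ne_zero g)

/-- The unit quaternion attached to a generator. -/
noncomputable def unit (g : Gen) : (ℍ[L,σ.t,0,σ.t])ˣ where
  val := σ.val (g, true)
  inv := σ.val (g, false)
  val_inv := σ.val_mul_val_not g true
  inv_val := σ.val_mul_val_not g false

lemma lift_unit_eq_one : ∀ r ∈ relators, FreeGroup.lift σ.unit r = 1 := by
  have h3 := σ.three_eq_zero
  rintro _ ⟨r, hr, rfl⟩
  simp only [relations, Set.mem_insert_iff, Set.mem_singleton_iff] at hr
  rcases hr with rfl | rfl | rfl | rfl <;>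
    simp only [map_mul, map_inv, mul_inv_eq_one, FreeGroup.lift_apply_of] <;>
    apply Units.ext <;>
    simp only [Units.val_mul, unit, Units.inv_mk, val, smul_mul_smul_comm, σ.root_b, σ.root_y,
      mul_comm] <;>
    congr 1 <;> ext <;> simp [letter, dir] <;> grind

/-- The representation of `Γ₃` by quaternions. -/
noncomputable def rep : Group3 →* (ℍ[L,σ.t,0,σ.t])ˣ :=
  PresentedGroup.toGroup (f := σ.unit) σ.lift_unit_eq_one

end Splitting
end Representation

/-! ### Faithfulness of the representation. -/

/-- The product of the quaternions of the letters of a word. -/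
noncomputable def wordQuat {R : Type*} [CommRing R] (c : R) (ι : Bool → Gen)
    (w : List (Bool × Bool)) : ℍ[R,c,0,c] :=
  (w.map fun p => letter c (ι p.1, p.2)).prod

lemma quatMap_wordQuat {R S : Type*} [CommRing R] [CommRing S] (f : R →+* S) {c : R} {d : S}
    (h : f c = d) (ι : Bool → Gen) (w : List (Bool × Bool)) :
    quatMap f h (wordQuat c ι w) = wordQuat d ι w := by
  simp [wordQuat, map_list_prod, Function.comp_def, quatMap_letter]

lemma wordQuat_mul_star {R : Type*} [CommRing R] (h3 : (3 : R) = 0) (c e : R) (ι : Bool → Gen)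
    (he : ∀ s, dirSq c (ι s) = e) (w : List (Bool × Bool)) :
    wordQuat c ι w * star (wordQuat c ι w) = (((1 - e) ^ w.length : R) : ℍ[R,c,0,c]) := by
  induction w with
  | nil => simp [wordQuat]
  | cons p w ih =>
    have : wordQuat c ι (p :: w) = letter c (ι p.1, p.2) * wordQuat c ι w := by simp [wordQuat]
    rw [this, star_mul, mul_assoc, ← mul_assoc (wordQuat c ι w), ih, QuaternionAlgebra.coe_commutes,
      ← mul_assoc, letter_mul_star h3, he, ← QuaternionAlgebra.coe_mul, List.length_cons, pow_succ']

lemma coe_mul_star_coe {R : Type*} [CommRing R] {c d : R} :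
    (d : ℍ[R,c,0,c]) * star (d : ℍ[R,c,0,c]) = ((d ^ 2 : R) : ℍ[R,c,0,c]) := by
  ext <;> simp [pow_two]

lemma eq_zero_of_mul_coe {F : Type*} [Field F] {c d : F} (hd : d ≠ 0) {q : ℍ[F,c,0,c]}
    (h : q * (d : ℍ[F,c,0,c]) = 0) : q = 0 := by
  rw [QuaternionAlgebra.mul_coe_eq_smul] at h
  exact (smul_eq_zero_iff_right hd).mp h

/-- The product of a horizontal and a vertical reduced word is a scalar only if both are empty. -/
lemma eq_nil_of_wordQuat_mul {h v : List (Bool × Bool)} (hh : FreeGroup.IsReduced h)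
    (hv : FreeGroup.IsReduced v) {c : (ZMod 3)[X]}
    (e : wordQuat X horizontal h * wordQuat X vertical v = (c : ℍ[(ZMod 3)[X],X,0,X])) :
    h = [] ∧ v = [] := by
  have nh := wordQuat_mul_star three_eq_zero X X horizontal (by rintro ⟨⟩ <;> rfl) h
  have nv := wordQuat_mul_star three_eq_zero X (-X) vertical (by rintro ⟨⟩ <;> rfl) v
  -- Norms are multiplicative, so a nonempty horizontal word forces `c(1) = 0`, and a nonempty
  -- vertical word forces `c(-1) = 0`.
  have hc : c ^ 2 = (1 - X) ^ h.length * (1 - -X) ^ v.length := by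
    apply QuaternionAlgebra.coe_injective (c₁ := (X : (ZMod 3)[X])) (c₂ := 0)
      (c₃ := (X : (ZMod 3)[X]))
    rw [← coe_mul_star_coe, ← e, star_mul, mul_assoc, ← mul_assoc (wordQuat X vertical v), nv,
      QuaternionAlgebra.coe_commutes, ← mul_assoc, nh, ← QuaternionAlgebra.coe_mul]
  constructor
  · by_contra hne
    have hlen : h.length ≠ 0 := by simpa using hne
    have c1 : c.eval 1 = 0 := by
      have := congrArg (eval 1) hc
      simpa [hlen] using this
    have E := congrArg (quatMap (evalRingHom (1 : ZMod 3)) (d := 1) (by simp)) e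
    rw [map_mul, quatMap_wordQuat, quatMap_wordQuat, quatMap_coe, coe_evalRingHom, c1] at E
    apply horizontal_word_ne_zero hh
    have nv' := wordQuat_mul_star (R := ZMod 3) (by decide) 1 (-1) vertical
      (by rintro ⟨⟩ <;> rfl) v
    -- At `X = 1` the vertical norm is a power of 2, invertible mod 3, so the vertical factor can be
    -- cancelled and the horizontal product itself vanishes.
    have hd : ((1 - -1) ^ v.length : ZMod 3) ≠ 0 := pow_ne_zero _ (by decide)
    apply eq_zero_of_mul_coe hd
    rw [← nv', ← mul_assoc]
    change wordQuat 1 horizontal h * _ * _ = 0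
    rw [E, QuaternionAlgebra.coe_zero, zero_mul]
  · by_contra hne
    have hlen : v.length ≠ 0 := by simpa using hne
    have c1 : c.eval (-1) = 0 := by
      have := congrArg (eval (-1)) hc
      simpa [hlen] using this
    have E := congrArg (quatMap (evalRingHom (-1 : ZMod 3)) (d := -1) (by simp)) e
    rw [map_mul, quatMap_wordQuat, quatMap_wordQuat, quatMap_coe, coe_evalRingHom, c1] at E
    apply vertical_word_ne_zero hv
    have nh' := wordQuat_mul_star (R := ZMod 3) (by decide) (-1) (-1) horizontal
      (by rintro ⟨⟩ <;> rfl) h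
    have hd : ((1 - -1) ^ h.length : ZMod 3) ≠ 0 := pow_ne_zero _ (by decide)
    apply eq_zero_of_mul_coe hd
    -- Cancelling on the left needs the norm in the order `star w * w`.
    have nh'' : star (wordQuat (-1 : ZMod 3) horizontal h) * wordQuat (-1) horizontal h =
        (((1 - -1) ^ h.length : ZMod 3) : ℍ[ZMod 3,-1,0,-1]) := by
      rw [← nh', QuaternionAlgebra.star_mul_eq_coe, QuaternionAlgebra.mul_star_eq_coe]
      congr 1
      simp
    rw [← QuaternionAlgebra.coe_commutes, ← nh'', mul_assoc]
    change _ * (_ * wordQuat (-1) vertical v) = 0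
    rw [E, QuaternionAlgebra.coe_zero, mul_zero]

namespace Splitting

variable {L : Type*} [Field L] (σ : Splitting L)

/-- The map of quaternion algebras induced by the embedding. -/
noncomputable def quatEmb : ℍ[(ZMod 3)[X],X,0,X] →+* ℍ[L,σ.t,0,σ.t] := quatMap σ.emb rfl

lemma quatEmb_wordQuat (ι : Bool → Gen) (w : List (Bool × Bool)) :
    σ.quatEmb (wordQuat X ι w) = wordQuat σ.t ι w :=
  quatMap_wordQuat σ.emb _ ι w

lemma rep_of (g : Gen) : σ.rep (PresentedGroup.of g) = σ.unit g := by
  simp [rep]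

lemma rep_word (ι : Bool → Gen) {ρ : L} (hρ : ∀ s, σ.root (ι s) = ρ) (w : List (Bool × Bool)) :
    (σ.rep (FreeGroup.lift (fun s => (PresentedGroup.of (ι s) : Group3)) (FreeGroup.mk w)) :
      ℍ[L,σ.t,0,σ.t]) = (ρ⁻¹) ^ w.length • σ.quatEmb (wordQuat X ι w) := by
  rw [quatEmb_wordQuat, FreeGroup.lift_mk]
  induction w with
  | nil => simp [wordQuat]
  | cons p w ih =>
    have hp : (σ.rep (cond p.2 (PresentedGroup.of (ι p.1) : Group3)
        (PresentedGroup.of (ι p.1))⁻¹) : ℍ[L,σ.t,0,σ.t]) = ρ⁻¹ • letter σ.t (ι p.1, p.2) := by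
      obtain ⟨s, e⟩ := p
      cases e
      · simp [rep_of, unit, val, hρ]
      · simp [rep_of, unit, val, hρ]
    have hw : wordQuat σ.t ι (p :: w) = letter σ.t (ι p.1, p.2) * wordQuat σ.t ι w := by
      simp [wordQuat]
    rw [List.map_cons, List.prod_cons, map_mul, Units.val_mul, ih, hp, hw, smul_mul_smul_comm,
      List.length_cons, pow_succ']

lemma rep_injective : Function.Injective σ.rep := by
  rw [injective_iff_map_eq_one]
  intro g hg
  obtain ⟨h, v, rfl⟩ := exists_normal_form g
  have rh := σ.rep_word horizontal (ρ := σ.root Gen.a)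
    (by rintro ⟨⟩; exacts [σ.root_b, rfl]) h.toWord
  have rv := σ.rep_word vertical (ρ := σ.root Gen.x)
    (by rintro ⟨⟩; exacts [σ.root_y, rfl]) v.toWord
  rw [FreeGroup.mk_toWord] at rh rv
  have e := congrArg Units.val hg
  rw [map_mul, Units.val_mul, rh, rv, smul_mul_smul_comm, ← map_mul, Units.val_one] at e
  set k := (σ.root Gen.a)⁻¹ ^ h.toWord.length * (σ.root Gen.x)⁻¹ ^ v.toWord.length with hk
  have hk0 : k ≠ 0 := mul_ne_zero (pow_ne_zero _ (inv_ne_zero (σ.root_ne_zero _)))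
    (pow_ne_zero _ (inv_ne_zero (σ.root_ne_zero _)))
  set q : ℍ[(ZMod 3)[X],X,0,X] := wordQuat X horizontal h.toWord * wordQuat X vertical v.toWord with hq
  have hz : ∀ p : (ZMod 3)[X], k * σ.emb p = 0 → p = 0 := fun p hp =>
    (map_eq_zero_iff _ σ.injective).mp ((mul_eq_zero.mp hp).resolve_left hk0)
  -- The image of `g` is `1`, and the scalar `k` is nonzero, so the imaginary coordinates of `q`
  -- vanish.
  have hqc : q = (q.re : ℍ[(ZMod 3)[X],X,0,X]) := by
    have e' := QuaternionAlgebra.ext_iff.mp e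
    ext1
    · rfl
    · exact hz _ e'.2.1
    · exact hz _ e'.2.2.1
    · exact hz _ e'.2.2.2
  obtain ⟨h1, v1⟩ := eq_nil_of_wordQuat_mul FreeGroup.isReduced_toWord
    FreeGroup.isReduced_toWord hqc
  rw [FreeGroup.toWord_eq_nil_iff] at h1 v1
  simp [h1, v1]

end Splitting

/-! ### Integer powers of generators and comparison of coordinates. -/

/-- The coefficient of `1` in the normalized power `(1 + q) ^ i` where `q ^ 2 = X`. -/
noncomputable def cInt (i : ℤ) : (ZMod 3)[X] := cPow i.natAbs

/-- The coefficient of `q` in the normalized power `(1 + q) ^ i` where `q ^ 2 = X`. -/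
noncomputable def sInt (i : ℤ) : (ZMod 3)[X] := (i.sign : (ZMod 3)[X]) * sPow i.natAbs

lemma cInt_natCast (n : ℕ) : cInt n = cPow n := rfl

lemma cInt_neg (i : ℤ) : cInt (-i) = cInt i := by simp [cInt]

lemma sInt_natCast (n : ℕ) : sInt n = sPow n := by
  cases n with
  | zero => simp [sInt]
  | succ n => simp [sInt, Int.sign_eq_one_of_pos (show (0 : ℤ) < (n : ℤ) + 1 by positivity),
      show ((n : ℤ) + 1).natAbs = n + 1 by lia]

lemma sInt_neg (i : ℤ) : sInt (-i) = -sInt i := by simp [sInt]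

lemma cInt_ne_zero (i : ℤ) : cInt i ≠ 0 := cPow_ne_zero _

lemma sInt_eq_zero_iff {i : ℤ} : sInt i = 0 ↔ i = 0 := by
  refine ⟨fun h => ?_, fun h => by simp [sInt, h]⟩
  by_contra hi
  rcases Int.eq_nat_or_neg i with ⟨n, rfl | rfl⟩
  · rw [sInt_natCast] at h; exact sPow_ne_zero (by simpa using hi) h
  · rw [sInt_neg, neg_eq_zero, sInt_natCast] at h; exact sPow_ne_zero (by simpa using hi) h

/-- Squaring removes the signs and gives `|i| = |j|`. If `i = -j`, the equation becomes `2 s_j c_j =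
0`, which forces `j = 0`. -/
lemma eq_of_sInt_mul_cInt {i j : ℤ} (h : sInt i * cInt j = sInt j * cInt i) : i = j := by
  by_cases hi : i = 0
  · subst hi
    have : sInt j = 0 := by
      have := h.symm
      rw [sInt_eq_zero_iff.mpr rfl, zero_mul, mul_eq_zero] at this
      exact this.resolve_right (cInt_ne_zero 0)
    exact (sInt_eq_zero_iff.mp this).symm
  have abs_eq : i.natAbs = j.natAbs := by
    have sq : ∀ i : ℤ, sInt i ^ 2 = sPow i.natAbs ^ 2 := by
      intro i
      rcases Int.eq_nat_or_neg i with ⟨n, rfl | rfl⟩ <;> simp [sInt_neg, sInt_natCast]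
    apply powCoeff_inj
    rw [← sq, ← sq]
    change sInt i ^ 2 * cInt j ^ 2 = sInt j ^ 2 * cInt i ^ 2
    rw [← mul_pow, h, mul_pow]
  rcases Int.natAbs_eq_natAbs_iff.mp abs_eq with rfl | rfl
  · rfl
  · rw [sInt_neg, cInt_neg] at h
    have h2 : sInt j * cInt j = 0 := by
      linear_combination h + sInt j * cInt j * three_eq_zero
    have hj : j = 0 := sInt_eq_zero_iff.mp ((mul_eq_zero.mp h2).resolve_right (cInt_ne_zero j))
    simp [hj]

lemma comp_neg_X_injective : Function.Injective fun p : (ZMod 3)[X] => p.comp (-X) := by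
  intro p q h
  simpa [comp_assoc] using congrArg (fun p => p.comp (-X)) h

lemma letter_pow (g : Gen) (n : ℕ) :
    letter X (g, true) ^ n =
        (((cPow n).comp (dirSq X g) : (ZMod 3)[X]) : ℍ[(ZMod 3)[X],X,0,X]) +
          (sPow n).comp (dirSq X g) • dir X g ∧
      letter X (g, false) ^ n =
        (((cPow n).comp (dirSq X g) : (ZMod 3)[X]) : ℍ[(ZMod 3)[X],X,0,X]) -
          (sPow n).comp (dirSq X g) • dir X g := by
  have hd := dir_mul_dir three_eq_zero (X : (ZMod 3)[X]) g
  induction n with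
  | zero => simp
  | succ n ih =>
    rw [pow_succ, pow_succ, ih.1, ih.2]
    simp only [letter, cond_true, cond_false, cPow_succ, sPow_succ, add_comp,
      mul_comp, X_comp, add_mul, sub_mul, mul_add, mul_sub, mul_one, smul_mul_assoc, hd,
      QuaternionAlgebra.smul_coe, QuaternionAlgebra.coe_add, QuaternionAlgebra.coe_mul_eq_smul,
      add_smul]
    rw [mul_comm (dirSq X g)]
    constructor <;> abel

/-- The quaternion `C + S q` for the power `i` of a generator. -/
noncomputable def powQuat (g : Gen) (i : ℤ) : ℍ[(ZMod 3)[X],X,0,X] :=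
  (((cInt i).comp (dirSq X g) : (ZMod 3)[X]) : ℍ[(ZMod 3)[X],X,0,X]) +
    (sInt i).comp (dirSq X g) • dir X g

/-- Coordinates of an equality `(p + q u) (p' + q' v) ~ (p₁ + q₁ v) (p₁' + q₁' w)` up to scalars. -/
lemma ratio_cases {L : Type*} [Field L] (h3 : (3 : L) = 0)
    {k₁ k₂ t p q p' q' p₁ q₁ p₁' q₁' : L} (hk₁ : k₁ ≠ 0) (hk₂ : k₂ ≠ 0) (hp : p ≠ 0)
    (hp' : p' ≠ 0) (hp₁ : p₁ ≠ 0) (hp₁' : p₁' ≠ 0)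
    (e1 : k₁ * (p * p' + q * q' * t) = k₂ * (p₁ * p₁' - q₁ * q₁' * t))
    (e2 : k₁ * (q * p' + p * q') = k₂ * (q₁ * p₁'))
    (e3 : k₁ * (-(p * q')) = k₂ * (p₁ * q₁' - q₁ * p₁'))
    (e4 : k₁ * (-(q * q')) = k₂ * (q₁ * q₁')) :
    (q = 0 ∧ q₁' = 0 ∧ q₁ * p' = q' * p₁) ∨
      (q ≠ 0 ∧ q * p₁' = q₁' * p ∧ q₁ * p' = -q' * p₁ ∧ q * p' = q' * p) := by
  have e5 : k₁ * (q * p') = k₂ * (p₁ * q₁') := by linear_combination e2 + e3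
  by_cases hq : q = 0
  · left
    subst hq
    have hq₁' : q₁' = 0 := by simpa [hk₂, hp₁] using e5.symm
    subst hq₁'
    refine ⟨rfl, rfl, ?_⟩
    apply mul_left_cancel₀ (mul_ne_zero hk₂ hp₁')
    linear_combination q' * e1 - p' * e2
  · right
    -- Adding `t` times the last coordinate to the first cancels the products of the `q`'s; `eK` and
    -- `e5` then serve to eliminate the unknown scalars `k₁, k₂`.
    have eK : k₁ * (p * p') = k₂ * (p₁ * p₁') := by linear_combination e1 + t * e4
    have f1 : q₁ * p' = -q' * p₁ := by
      apply mul_left_cancel₀ (mul_ne_zero hk₁ hq)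
      linear_combination q₁ * e5 - p₁ * e4
    refine ⟨hq, ?_, f1, ?_⟩
    · apply mul_left_cancel₀ (mul_ne_zero hk₁ (mul_ne_zero hp hp'))
      linear_combination p * p₁' * e5 - q₁' * p * eK
    · apply mul_left_cancel₀ (mul_ne_zero hk₁ hp')
      linear_combination p' * e2 + k₂ * p₁' * f1 + q' * eK - k₁ * p' * q' * p * h3

namespace Splitting

variable {L : Type*} [Field L] (σ : Splitting L)

lemma quatEmb_letter (p : Gen × Bool) : σ.quatEmb (letter X p) = letter σ.t p :=
  quatMap_letter σ.emb _ p

lemma rep_zpow (g : Gen) (i : ℤ) :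
    ((σ.rep (PresentedGroup.of g) ^ i : (ℍ[L,σ.t,0,σ.t])ˣ) : ℍ[L,σ.t,0,σ.t]) =
      (σ.root g)⁻¹ ^ i.natAbs • σ.quatEmb (powQuat g i) := by
  have hl : ∀ s, σ.val (g, s) = (σ.root g)⁻¹ • σ.quatEmb (letter X (g, s)) := fun s => by
    rw [quatEmb_letter, val]
  rw [rep_of]
  rcases Int.eq_nat_or_neg i with ⟨n, rfl | rfl⟩
  · rw [zpow_natCast, Units.val_pow_eq_pow_val]
    change σ.val (g, true) ^ n = _
    rw [hl, _root_.smul_pow, ← map_pow, (letter_pow g n).1, powQuat, cInt_natCast, sInt_natCast,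
      Int.natAbs_natCast]
  · rw [zpow_neg, zpow_natCast, ← inv_pow, Units.val_pow_eq_pow_val]
    change σ.val (g, false) ^ n = _
    rw [hl, _root_.smul_pow, ← map_pow, (letter_pow g n).2, powQuat, cInt_neg, sInt_neg, cInt_natCast,
      sInt_natCast, Int.natAbs_neg, Int.natAbs_natCast, neg_comp, neg_smul, sub_eq_add_neg]

lemma rep_mul_zpow (g g' : Gen) (i j : ℤ) :
    (σ.rep (PresentedGroup.of g ^ i * PresentedGroup.of g' ^ j) : ℍ[L,σ.t,0,σ.t]) =
      ((σ.root g)⁻¹ ^ i.natAbs * (σ.root g')⁻¹ ^ j.natAbs) •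
        σ.quatEmb (powQuat g i * powQuat g' j) := by
  rw [map_mul, map_zpow, map_zpow, Units.val_mul, rep_zpow, rep_zpow, smul_mul_smul_comm, map_mul]

end Splitting

lemma mem_of_ratio_eq {i j : ℤ} (h : sInt i * (cInt j).comp (-X) = (sInt j).comp (-X) * cInt i) :
    a ^ i * x ^ j = x ^ (-j) * b ^ i := by
  obtain ⟨L, _, ⟨σ⟩⟩ := exists_splitting
  apply σ.rep_injective
  apply Units.ext
  have e1 := σ.rep_mul_zpow Gen.a Gen.x i j
  have e2 := σ.rep_mul_zpow Gen.x Gen.b (-j) i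
  refine e1.trans (Eq.trans ?_ e2.symm)
  -- The normalizing scalars agree, since they depend only on absolute values and on the shared
  -- roots, so only the polynomial quaternions remain to be compared.
  rw [σ.root_b, Int.natAbs_neg, mul_comm]
  refine congrArg (fun q => _ • σ.quatEmb q) ?_
  have h3 := three_eq_zero
  simp only [powQuat, dirSq, comp_X, cInt_neg, sInt_neg, neg_comp]
  ext1 <;> simp [dir]
  · ring
  · linear_combination h + cInt i * (sInt j).comp (-X) * h3
  · linear_combination -h - cInt i * (sInt j).comp (-X) * h3
  · ring

lemma ratio_of_mem {i j k l : ℤ} (h : a ^ i * x ^ j = x ^ (-k) * b ^ l) :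
    (i = 0 ∧ l = 0 ∧ k = -j) ∨
      (i ≠ 0 ∧ l = i ∧ k = j ∧ sInt i * (cInt j).comp (-X) = (sInt j).comp (-X) * cInt i) := by
  obtain ⟨L, _, ⟨σ⟩⟩ := exists_splitting
  have e1 := σ.rep_mul_zpow Gen.a Gen.x i j
  have e2 := σ.rep_mul_zpow Gen.x Gen.b (-k) l
  have e := e1.symm.trans ((congrArg (fun g => (σ.rep g : ℍ[L,σ.t,0,σ.t])) h).trans e2)
  have hk : ∀ (g g' : Gen) (i j : ℤ),
      (σ.root g)⁻¹ ^ i.natAbs * (σ.root g')⁻¹ ^ j.natAbs ≠ 0 := fun g g' i j =>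
    mul_ne_zero (pow_ne_zero _ (inv_ne_zero (σ.root_ne_zero _)))
      (pow_ne_zero _ (inv_ne_zero (σ.root_ne_zero _)))
  have hk₁ := hk Gen.a Gen.x i j
  have hk₂ := hk Gen.x Gen.b (-k) l
  have hne : ∀ i, σ.emb (cInt i) ≠ 0 := fun i =>
    (map_ne_zero_iff _ σ.injective).mpr (cInt_ne_zero i)
  have hne' : ∀ i, σ.emb ((cInt i).comp (-X)) ≠ 0 := fun i =>
    (map_ne_zero_iff _ σ.injective).mpr fun h0 =>
      cInt_ne_zero i (comp_neg_X_injective (h0.trans zero_comp.symm))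
  generalize (σ.root Gen.a)⁻¹ ^ i.natAbs * (σ.root Gen.x)⁻¹ ^ j.natAbs = k₁ at e hk₁
  generalize (σ.root Gen.x)⁻¹ ^ (-k).natAbs * (σ.root Gen.b)⁻¹ ^ l.natAbs = k₂ at e hk₂
  have ee := QuaternionAlgebra.ext_iff.mp e
  simp only [powQuat, dirSq, comp_X] at ee
  simp [Splitting.quatEmb, quatMap, dir] at ee
  have key := ratio_cases σ.three_eq_zero (t := σ.emb X) hk₁ hk₂ (hne i) (hne' j) (hne' (-k)) (hne l)
    (q := σ.emb (sInt i)) (q' := σ.emb ((sInt j).comp (-X))) (q₁ := σ.emb ((sInt (-k)).comp (-X)))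
    (q₁' := σ.emb (sInt l)) (by linear_combination ee.1) (by linear_combination ee.2.1)
    (by linear_combination ee.2.2.1) (by linear_combination ee.2.2.2)
  simp only [← map_mul, ← map_neg, map_eq_zero_iff _ σ.injective, σ.injective.eq_iff,
    sInt_eq_zero_iff, ne_eq] at key
  rcases key with ⟨hi, hl, h1⟩ | ⟨hi, hl, h1, h2⟩
  · left
    refine ⟨hi, hl, ?_⟩
    have : sInt (-k) * cInt j = sInt j * cInt (-k) := by
      apply comp_neg_X_injective; simpa using h1
    have := eq_of_sInt_mul_cInt this
    lia
  · right
    refine ⟨hi, (eq_of_sInt_mul_cInt hl).symm, ?_, h2⟩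
    apply eq_of_sInt_mul_cInt
    apply comp_neg_X_injective
    simpa [sInt_neg, cInt_neg] using h1

/-! ### Integer solutions of the ratio equation. -/

lemma exists_pow_of_ratio_eq {i j : ℤ} (hi : i ≠ 0)
    (h : sInt i * (cInt j).comp (-X) = (sInt j).comp (-X) * cInt i) :
    ∃ n : ℕ, (i = 3 ^ n ∨ i = -3 ^ n) ∧ j = (-1) ^ n * i := by
  have hj : j ≠ 0 := by
    rintro rfl
    rw [sInt_eq_zero_iff.mpr rfl, zero_comp, zero_mul, mul_eq_zero] at h
    rcases h with h | h
    · exact hi (sInt_eq_zero_iff.mp h)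
    · exact cInt_ne_zero 0 (comp_neg_X_injective (h.trans zero_comp.symm))
  have hs : ∀ {i : ℤ}, i ≠ 0 → i.sign = 1 ∨ i.sign = -1 := fun {i} hi => by
    rcases lt_or_gt_of_ne hi with h | h
    · exact Or.inr (Int.sign_eq_neg_one_of_neg h)
    · exact Or.inl (Int.sign_eq_one_of_pos h)
  -- The signs of `i` and `j` multiply the `s`-coefficients only, so together they form the sign `σ`
  -- of the matching.
  have hm : Matched (i.sign * j.sign) i.natAbs j.natAbs := by
    unfold Matched
    simp only [sInt, cInt, mul_comp, intCast_comp] at h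
    rcases hs hi with h1 | h1 <;> simp only [h1] at h ⊢ <;> push_cast at h ⊢
    · linear_combination h
    · linear_combination -h
  have hpm : i.sign * j.sign = 1 ∨ i.sign * j.sign = -1 := by
    rcases hs hi with h1 | h1 <;> rcases hs hj with h2 | h2 <;> simp [h1, h2]
  obtain ⟨n, h1, h2, h3⟩ := hm.exists_pow hpm (by simpa using hi)
  have ei := Int.sign_mul_natAbs i
  have ej := Int.sign_mul_natAbs j
  rw [h1] at ei
  rw [h2] at ej
  push_cast at ei ej
  refine ⟨n, ?_, ?_⟩
  · rcases hs hi with h | h <;> rw [h] at ei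
    · left; linarith
    · right; linarith
  · rw [← h3]
    have hsq : i.sign ^ 2 = 1 := by rcases hs hi with h | h <;> simp [h]
    linear_combination i.sign * j.sign * ei - ej - j.sign * 3 ^ n * hsq

lemma ratio_eq_of_pow (n : ℕ) : ∀ i : ℤ, i = 3 ^ n ∨ i = -3 ^ n →
    sInt i * (cInt ((-1) ^ n * i)).comp (-X) = (sInt ((-1) ^ n * i)).comp (-X) * cInt i := by
  have h := matched_three_pow n
  unfold Matched at h
  have hc : cInt (3 ^ n) = cPow (3 ^ n) := by exact_mod_cast cInt_natCast (3 ^ n)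
  have hs : sInt (3 ^ n) = sPow (3 ^ n) := by exact_mod_cast sInt_natCast (3 ^ n)
  rintro i (rfl | rfl) <;> rcases neg_one_pow_eq_or ℤ n with h1 | h1 <;> rw [h1] at h ⊢ <;>
    simp [cInt_neg, sInt_neg, hc, hs] at h ⊢ <;>
    first | exact h | linear_combination h | linear_combination -h

end Gamma3

theorem mainTheorem5 :
    Gamma3.P =
      {((0 : ℤ), (0 : ℤ), (0 : ℤ), (0 : ℤ))} ∪
      {t : ℤ × ℤ × ℤ × ℤ | ∃ n : ℤ, t = (0, n, -n, 0)} ∪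
      {t : ℤ × ℤ × ℤ × ℤ | ∃ n : ℕ, Odd n ∧
        (t = (3 ^ n, -3 ^ n, -3 ^ n, 3 ^ n) ∨ t = -(3 ^ n, -3 ^ n, -3 ^ n, 3 ^ n))} ∪
      {t : ℤ × ℤ × ℤ × ℤ | ∃ n : ℕ, Even n ∧
        (t = (3 ^ n, 3 ^ n, 3 ^ n, 3 ^ n) ∨ t = -(3 ^ n, 3 ^ n, 3 ^ n, 3 ^ n))} := by
  ext ⟨i, j, k, l⟩
  constructor
  · intro h
    rcases Gamma3.ratio_of_mem h with ⟨rfl, rfl, rfl⟩ | ⟨hi, rfl, rfl, hr⟩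
    -- The zero tuple needs no separate case here: it is the member `j = 0` of this family.
    · exact Or.inl (Or.inl (Or.inr ⟨j, rfl⟩))
    · obtain ⟨n, hn, rfl⟩ := Gamma3.exists_pow_of_ratio_eq hi hr
      rcases Nat.even_or_odd n with he | ho
      · refine Or.inr ⟨n, he, ?_⟩
        rcases hn with rfl | rfl <;> simp [he.neg_one_pow]
      · refine Or.inl (Or.inr ⟨n, ho, ?_⟩)
        rcases hn with rfl | rfl <;> simp [ho.neg_one_pow]
  · have main : ∀ (n : ℕ) (i : ℤ), i = 3 ^ n ∨ i = -3 ^ n →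
        (i, (-1) ^ n * i, (-1) ^ n * i, i) ∈ Gamma3.P := fun n i hi =>
      Gamma3.mem_of_ratio_eq (Gamma3.ratio_eq_of_pow n i hi)
    rintro (((h | ⟨n, h⟩) | ⟨n, hn, h⟩) | ⟨n, hn, h⟩)
    · rw [h]; simp [Gamma3.P]
    · rw [h]; simp [Gamma3.P]
    · rcases h with h | h <;> rw [h]
      · simpa [hn.neg_one_pow] using main n _ (Or.inl rfl)
      · simpa [hn.neg_one_pow] using main n _ (Or.inr rfl)
    · rcases h with h | h <;> rw [h]
      · simpa [hn.neg_one_pow] using main n _ (Or.inl rfl)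
      · simpa [hn.neg_one_pow] using main n _ (Or.inr rfl)
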